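/- Let $n\ge 4$ and let $G=(N,A)$ be the complete directed graph with node set $N=\{1,\dots,n\}$ and arc set $A=\{ij : i,j\in N,\ i\ne j\}$. Put $N_1=N\setminus\{1\}$ and $A_1=\{ij : i,j\in N_1,\ i\neq j\}$, and let $\mathcal C_1$ be the set of (simple) directed cycles with arcs in $A_1$, each cycle $C$ being regarded as its set of arcs (cycles with two arcs $ij,ji$ are allowed), so that $|C|$ is its number of arcs. Let $$D=\Big\{d\in\mathbb R^{A_1} : d_{ij}>0\ \text{for all } ij\in A_1,\ \sum_{ij\in C}d_{ij}\le 1\ \text{for all } C\in\mathcal C_1\Big\}$$ and let $\overline D$ be its topological closure. Let $P_{\mathrm{AP}}$ be the set of $x\in[0,1]^A$ with $\sum_{j\ne i}x_{ij}=1$ and $\sum_{j\neq i}x_{ji}=1$ for all $i\in N$. For $d\in\overline D$ let $$P_{\mathrm{MTZ}}(d)=\Big\{x\in P_{\mathrm{AP}} : \exists\,u\in\mathbb R^{N_1}\ \text{with}\ u_i-u_j+d_{ij}\le 1-x_{ij}\ \text{for all } ij\in A_1\Big\}.$$ Then for each $d\in\overline D$ and each $C\in\mathcal C_1$, the inequality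 $$\sum_{ij\in C}x_{ij}\le |C|-\sum_{ij\in C}d_{ij}$$ defines a facet of $P_{\mathrm{MTZ}}(d)$ (that is, it is valid for $P_{\mathrm{MTZ}}(d)$ and the face of points of $P_{\mathrm{MTZ}}(d)$ satisfying it with equality is nonempty and has dimension $\dim P_{\mathrm{MTZ}}(d)-1$) if and only if $\sum_{ij\in C}d_{ij}>0$ and $|C|\le n-2$. -/

import Mathlib

namespace ATSP

/-- Arcs of the complete directed graph on the `n` nodes `Fin n`. An arc `a` is the ordered pair
`(a.1.1, a.1.2)` of distinct nodes. -/
abbrev Arc (n : ℕ) : Type := {p : Fin n × Fin n // p.1 ≠ p.2}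

/-- All nodes except the special one; the special node is the one with value `0`. -/
abbrev Node₁ (n : ℕ) : Type := {i : Fin n // i.val ≠ 0}

/-- The arcs both of whose ends are different from the special node. -/
abbrev Arc₁ (n : ℕ) : Type := {a : Arc n // a.1.1.val ≠ 0 ∧ a.1.2.val ≠ 0}

/-- The tail `i` of an arc `ij` avoiding the special node. -/
def Arc₁.src {n : ℕ} (a : Arc₁ n) : Node₁ n := ⟨a.1.1.1, a.2.1⟩

/-- The head `j` of an arc `ij` avoiding the special node. -/
def Arc₁.tgt {n : ℕ} (a : Arc₁ n) : Node₁ n := ⟨a.1.1.2, a.2.2⟩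

/-- `C`, a set of arcs avoiding the special node, is a (simple) directed cycle: it consists of the
arcs `v 0 → v 1 → ⋯ → v (k + 1) → v 0` for distinct nodes `v 0, …, v (k + 1)`, `k + 2 ≥ 2`.
Addition in `Fin (k + 2)` is cyclic. -/
def IsDirectedCycle {n : ℕ} (C : Finset (Arc₁ n)) : Prop :=
  ∃ (k : ℕ) (v : Fin (k + 2) → Node₁ n), Function.Injective v ∧
    ∀ a : Arc₁ n, a ∈ C ↔ ∃ i : Fin (k + 2), a.src = v i ∧ a.tgt = v (i + 1)

/-- The parameter set: positive vectors `d` whose sum along each directed cycle avoiding the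
special node is at most one. -/
def paramD (n : ℕ) : Set (Arc₁ n → ℝ) :=
  {d | (∀ a, 0 < d a) ∧ ∀ C : Finset (Arc₁ n), IsDirectedCycle C → ∑ a ∈ C, d a ≤ 1}

/-- The (restricted) assignment polytope. -/
def PAP (n : ℕ) : Set (Arc n → ℝ) :=
  {x | (∀ a, 0 ≤ x a ∧ x a ≤ 1) ∧
    (∀ i : Fin n, ∑ a : Arc n with a.1.1 = i, x a = 1) ∧
    (∀ i : Fin n, ∑ a : Arc n with a.1.2 = i, x a = 1)}

/-- The continuous relaxation of the extended `d`-MTZ formulation. -/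
def QMTZ {n : ℕ} (d : Arc₁ n → ℝ) : Set ((Arc n → ℝ) × (Node₁ n → ℝ)) :=
  {p | p.1 ∈ PAP n ∧ ∀ a : Arc₁ n, p.2 a.src - p.2 a.tgt + d a ≤ 1 - p.1 a.1}

/-- The projection of `QMTZ d` onto the `x` variables. -/
def PMTZ {n : ℕ} (d : Arc₁ n → ℝ) : Set (Arc n → ℝ) :=
  {x | ∃ u : Node₁ n → ℝ, (x, u) ∈ QMTZ d}

/-- The dimension of (the affine hull of) a nonempty set. -/
noncomputable def dimension {E : Type*} [AddCommGroup E] [Module ℝ E] (S : Set E) : ℕ :=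
  Module.finrank ℝ (vectorSpan ℝ S)

/-- The linear inequality `f x ≤ β` defines a facet of `P`: it is valid for `P`, and the face
`{x ∈ P | f x = β}` is nonempty and has dimension `dim P - 1`. -/
def DefinesFacet {E : Type*} [AddCommGroup E] [Module ℝ E]
    (P : Set E) (f : E →ₗ[ℝ] ℝ) (β : ℝ) : Prop :=
  (∀ x ∈ P, f x ≤ β) ∧ {x ∈ P | f x = β}.Nonempty ∧
    dimension {x ∈ P | f x = β} + 1 = dimension P

/-- The linear form `x ↦ ∑_{ij ∈ C} x_{ij}`. -/
def cycleSum {n : ℕ} (C : Finset (Arc₁ n)) : (Arc n → ℝ) →ₗ[ℝ] ℝ :=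
  ∑ a ∈ C, LinearMap.proj a.1

theorem cycleSum_apply {n : ℕ} (C : Finset (Arc₁ n)) (x : Arc n → ℝ) :
    cycleSum C x = ∑ a ∈ C, x a.1 := by
  simp [cycleSum]

end ATSP

/-! Eliminating `u`: a potential exists exactly when no directed cycle has negative weight for the
weights `1 - x - d`, so `PMTZ d` is the assignment polytope cut by the cycle inequalities
(`mem_PMTZ_iff`). The right-hand sides are at least `|C| - 1` since `d` sums to at most one on
cycles. The uniform assignment is positive and satisfies all of them strictly, so the polytope spans
the whole `flowSpace`.

Sufficiency: if `0 < d(C)` and `|C| ≤ n - 2`, there is a positive point tight for `C` and strict for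
every other cycle (`IsDirectedCycle.exists_point`). The face then spans the hyperplane of
`flowSpace` where the cycle sum vanishes.

Necessity: in each failing case two consecutive arcs are constant on the face. If `d(C) = 0`, the
arcs of `C` are fixed at 1; if `|C| ≥ n - 1`, the reversed arcs are fixed at 0. Either way the
codimension is at least two (`dimension_add_two_le`). -/

namespace ATSP

open Finset Module

/-! ### Feasible potentials and nonnegative cycles -/

section Potentials

variable {V : Type*} {w : V → V → ℝ}

/-- If all simple cycles have nonnegative weight then so do all closed walks. -/
theorem closedWalk_nonneg (hdiag : ∀ p, w p p = 0)
    (hcyc : ∀ (k : ℕ) (v : Fin (k + 2) → V), Function.Injective v →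
      0 ≤ ∑ i, w (v i) (v (i + 1))) :
    ∀ (m : ℕ) (f : ℕ → V), f m = f 0 → 0 ≤ ∑ t ∈ range m, w (f t) (f (t + 1)) := by
  intro m
  induction m using Nat.strong_induction_on with
  | _ m ih =>
  intro f hf
  by_cases hinj : ∀ p q, p < q → q < m → f p ≠ f q
  · match m, ih, hf, hinj with
    | 0, _, _, _ => simp
    | 1, _, hf, _ => simp [hf, hdiag]
    | k + 2, _, hf, hinj =>
      have hv : Function.Injective (fun i : Fin (k + 2) => f i) := by
        intro i j hij
        rcases lt_trichotomy i j with h | h | h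
        · exact absurd hij (hinj _ _ h j.2)
        · exact h
        · exact absurd hij.symm (hinj _ _ h i.2)
      refine (hcyc k _ hv).trans_eq ?_
      rw [← Fin.sum_univ_eq_sum_range (fun t => w (f t) (f (t + 1)))]
      refine Finset.sum_congr rfl fun i _ => ?_
      congr 1
      rw [Fin.val_add_one]
      split_ifs with h
      · simp [h, hf]
      · rfl
  · push Not at hinj
    -- A repeated node splits the walk into the loop from `p` to `q` and the walk that skips it;
    -- both are shorter and closed.
    obtain ⟨p, q, hpq, hqm, hfpq⟩ := hinj
    obtain ⟨s, rfl⟩ := Nat.exists_eq_add_of_lt hpq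
    obtain ⟨r, rfl⟩ := Nat.exists_eq_add_of_lt hqm
    have h1 := ih (s + 1) (by omega) (fun t => f (p + t)) (by simpa [add_assoc] using hfpq.symm)
    have hg : ∀ t ≤ p, (if t < p then f t else f (t + (s + 1))) = f t := by
      intro t ht
      split_ifs with h
      · rfl
      · obtain rfl : t = p := by omega
        exact hfpq.symm
    have h2 := ih (p + (r + 1)) (by omega) (fun t => if t < p then f t else f (t + (s + 1)))
      (by
        rw [hg 0 (by omega), ← hf, if_neg (by omega)]
        congr 1; omega)
    have e : p + s + 1 + r + 1 = p + ((s + 1) + (r + 1)) := by omega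
    rw [e, Finset.sum_range_add, Finset.sum_range_add]
    rw [Finset.sum_range_add] at h2
    have e1 : ∑ t ∈ range p, w (if t < p then f t else f (t + (s + 1)))
        (if t + 1 < p then f (t + 1) else f (t + 1 + (s + 1)))
        = ∑ t ∈ range p, w (f t) (f (t + 1)) := by
      refine Finset.sum_congr rfl fun t ht => ?_
      have := Finset.mem_range.1 ht
      rw [hg t (by omega), hg (t + 1) (by omega)]
    have e2 : ∑ t ∈ range (r + 1), w (if p + t < p then f (p + t) else f (p + t + (s + 1)))
        (if p + t + 1 < p then f (p + t + 1) else f (p + t + 1 + (s + 1)))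
        = ∑ t ∈ range (r + 1), w (f (p + (s + 1 + t))) (f (p + (s + 1 + t) + 1)) := by
      refine Finset.sum_congr rfl fun t ht => ?_
      rw [if_neg (by omega), if_neg (by omega)]
      congr 2 <;> omega
    simp only [e1, e2] at h2
    simp only [← add_assoc] at h1 h2 ⊢
    linarith

/-- If all closed walks have nonnegative weight, there is a feasible potential. -/
theorem exists_potential
    (hw : ∀ (m : ℕ) (f : ℕ → V), f m = f 0 → 0 ≤ ∑ t ∈ range m, w (f t) (f (t + 1))) :
    ∃ u : V → ℝ, ∀ i j, u i - u j ≤ w i j := by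
  rcases isEmpty_or_nonempty V with hV | ⟨⟨r⟩⟩
  · exact ⟨fun _ => 0, fun i => (hV.false i).elim⟩
  -- The potential is the shortest-walk distance to a fixed root `r`. It is bounded below because
  -- prepending the step from `r` to `i` closes the walk.
  let S : V → Set ℝ := fun i =>
    {s | ∃ (m : ℕ) (f : ℕ → V), f 0 = i ∧ f m = r ∧ s = ∑ t ∈ range m, w (f t) (f (t + 1))}
  have hne : ∀ i, (S i).Nonempty := fun i =>
    ⟨_, 1, fun t => if t = 0 then i else r, by simp, by simp, rfl⟩
  have hcons : ∀ i j, ∀ s ∈ S j, w i j + s ∈ S i := by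
    rintro i j s ⟨m, f, h0, hm, rfl⟩
    refine ⟨m + 1, fun t => Nat.casesOn t i f, rfl, hm, ?_⟩
    rw [Finset.sum_range_succ']
    simp [h0, add_comm]
  have hbdd : ∀ i, BddBelow (S i) := by
    intro i
    refine ⟨-w r i, fun s hs => ?_⟩
    obtain ⟨m, f, h0, hm, h⟩ := hcons r i s hs
    have := hw m f (hm.trans h0.symm)
    linarith
  refine ⟨fun i => sInf (S i), fun i j => ?_⟩
  have : sInf (S i) - w i j ≤ sInf (S j) := le_csInf (hne j) fun s hs => by
    have := csInf_le (hbdd i) (hcons i j s hs)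
    linarith
  linarith

end Potentials

/-! ### Directed cycles and the projection onto `x` -/

section Cycles

variable {n : ℕ}

theorem Arc₁.ext_src_tgt {a b : Arc₁ n} (h1 : a.src = b.src) (h2 : a.tgt = b.tgt) : a = b :=
  Subtype.ext <| Subtype.ext <| Prod.ext (congrArg Subtype.val h1) (congrArg Subtype.val h2)

/-- The arc joining two distinct nodes. -/
def arcOf (p q : Node₁ n) (h : p ≠ q) : Arc₁ n :=
  ⟨⟨(p.1, q.1), fun h' => h (Subtype.ext h')⟩, p.2, q.2⟩

theorem fin_ne_add_one {k : ℕ} (i : Fin (k + 2)) : i ≠ i + 1 := by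
  intro h
  have := left_eq_add.1 h
  exact absurd this (by simp)

theorem IsDirectedCycle.exists_arcs {C : Finset (Arc₁ n)} (hC : IsDirectedCycle C) :
    ∃ (k : ℕ) (e : Fin (k + 2) → Arc₁ n), Function.Injective (fun i => (e i).src) ∧
      (∀ i, (e i).tgt = (e (i + 1)).src) ∧ ∀ a, a ∈ C ↔ ∃ i, e i = a := by
  obtain ⟨k, v, hv, h⟩ := hC
  refine ⟨k, fun i => arcOf (v i) (v (i + 1)) (fun h => fin_ne_add_one i (hv h)), hv,
    fun i => rfl, fun a => (h a).trans (exists_congr fun i => ?_)⟩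
  constructor
  · rintro ⟨h1, h2⟩
    exact Arc₁.ext_src_tgt h1.symm h2.symm
  · rintro rfl
    exact ⟨rfl, rfl⟩

theorem isDirectedCycle_of_arcs {k : ℕ} (e : Fin (k + 2) → Arc₁ n)
    (he : Function.Injective (fun i => (e i).src)) (h : ∀ i, (e i).tgt = (e (i + 1)).src) :
    IsDirectedCycle (univ.image e) := by
  refine ⟨k, _, he, fun a => ?_⟩
  simp only [Finset.mem_image, Finset.mem_univ, true_and]
  refine exists_congr fun i => ⟨?_, ?_⟩
  · rintro rfl
    exact ⟨rfl, h i⟩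
  · rintro ⟨h1, h2⟩
    exact Arc₁.ext_src_tgt h1.symm ((h i).trans h2.symm)

theorem eq_image_of_mem_iff {k : ℕ} {C : Finset (Arc₁ n)} {e : Fin (k + 2) → Arc₁ n}
    (h : ∀ a, a ∈ C ↔ ∃ i, e i = a) : C = univ.image e := by
  ext a; simp [h]

theorem injective_of_src {k : ℕ} {e : Fin (k + 2) → Arc₁ n}
    (he : Function.Injective (fun i => (e i).src)) : Function.Injective e :=
  fun _ _ h => he (congrArg Arc₁.src h)

namespace IsDirectedCycle

variable {C : Finset (Arc₁ n)}

theorem two_le_card (hC : IsDirectedCycle C) : 2 ≤ C.card := by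
  obtain ⟨k, e, he, -, h⟩ := hC.exists_arcs
  rw [eq_image_of_mem_iff h, Finset.card_image_of_injective _ (injective_of_src he)]
  simp

theorem exists_succ (hC : IsDirectedCycle C) {a : Arc₁ n} (ha : a ∈ C) :
    ∃ b ∈ C, b.src = a.tgt := by
  obtain ⟨k, e, he, hs, h⟩ := hC.exists_arcs
  obtain ⟨i, rfl⟩ := (h a).1 ha
  exact ⟨e (i + 1), (h _).2 ⟨_, rfl⟩, (hs i).symm⟩

theorem exists_pred (hC : IsDirectedCycle C) {b : Arc₁ n} (hb : b ∈ C) :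
    ∃ a ∈ C, a ≠ b ∧ a.tgt = b.src := by
  obtain ⟨k, e, he, hs, h⟩ := hC.exists_arcs
  obtain ⟨i, rfl⟩ := (h b).1 hb
  refine ⟨e (i - 1), (h _).2 ⟨_, rfl⟩, fun h' => ?_, by simpa using hs (i - 1)⟩
  have := fin_ne_add_one (i - 1)
  rw [sub_add_cancel] at this
  exact this (injective_of_src he h')

theorem eq_of_src_eq (hC : IsDirectedCycle C) {a b : Arc₁ n} (ha : a ∈ C) (hb : b ∈ C)
    (hab : a.src = b.src) : a = b := by
  obtain ⟨k, e, he, hs, h⟩ := hC.exists_arcs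
  obtain ⟨i, rfl⟩ := (h a).1 ha
  obtain ⟨j, rfl⟩ := (h b).1 hb
  rw [he hab]

theorem eq_of_tgt_eq (hC : IsDirectedCycle C) {a b : Arc₁ n} (ha : a ∈ C) (hb : b ∈ C)
    (hab : a.tgt = b.tgt) : a = b := by
  obtain ⟨k, e, he, hs, h⟩ := hC.exists_arcs
  obtain ⟨i, rfl⟩ := (h a).1 ha
  obtain ⟨j, rfl⟩ := (h b).1 hb
  rw [hs, hs] at hab
  rw [add_right_cancel (he hab)]

/-- Successors are unique in `C`, so following `C'` from any of its arcs traverses all of `C`. -/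
theorem eq_of_subset (hC : IsDirectedCycle C) {C' : Finset (Arc₁ n)} (hC' : IsDirectedCycle C')
    (hsub : C' ⊆ C) : C' = C := by
  refine hsub.antisymm fun a ha => ?_
  obtain ⟨k, e, he, hs, h⟩ := hC.exists_arcs
  obtain ⟨b, hb⟩ : C'.Nonempty := Finset.card_pos.1 (by have := hC'.two_le_card; omega)
  obtain ⟨j, rfl⟩ := (h b).1 (hsub hb)
  obtain ⟨i, rfl⟩ := (h a).1 ha
  have key : ∀ t, e (j + t) ∈ C' := by
    intro t
    induction t using Fin.induction with
    | zero => simpa using hb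
    | succ t ih =>
      obtain ⟨c, hc, hct⟩ := hC'.exists_succ ih
      rw [hs] at hct
      have := hC.eq_of_src_eq (hsub hc) ((h _).2 ⟨_, rfl⟩) hct
      rwa [this, add_assoc, Fin.coeSucc_eq_succ] at hc
  have := key (i - j)
  rwa [add_sub_cancel] at this

theorem sum_potential (hC : IsDirectedCycle C) (u : Node₁ n → ℝ) :
    ∑ a ∈ C, (u a.src - u a.tgt) = 0 := by
  obtain ⟨k, e, he, hs, h⟩ := hC.exists_arcs
  rw [eq_image_of_mem_iff h, Finset.sum_image (injective_of_src he).injOn]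
  simp only [hs, Finset.sum_sub_distrib]
  rw [sub_eq_zero]
  exact (Equiv.sum_comp (Equiv.addRight (1 : Fin (k + 2))) (fun i => u (e i).src)).symm

end IsDirectedCycle

/-- The projection of the extended formulation is described by the cycle inequalities. -/
theorem mem_PMTZ_iff {d : Arc₁ n → ℝ} {x : Arc n → ℝ} :
    x ∈ PMTZ d ↔ x ∈ PAP n ∧
      ∀ C, IsDirectedCycle C → cycleSum C x ≤ (C.card : ℝ) - ∑ a ∈ C, d a := by
  constructor
  · rintro ⟨u, hx, hu⟩
    refine ⟨hx, fun C hC => ?_⟩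
    have h1 := hC.sum_potential u
    have h2 : ∑ a ∈ C, (x a.1 + d a + (u a.src - u a.tgt)) ≤ ∑ a ∈ C, (1 : ℝ) :=
      Finset.sum_le_sum fun a _ => by
        have := hu a
        simp only at this
        linarith
    rw [Finset.sum_add_distrib, Finset.sum_add_distrib, h1] at h2
    simp only [Finset.sum_const, nsmul_eq_mul, mul_one] at h2
    rw [cycleSum_apply]
    linarith
  · rintro ⟨hx, h⟩
    classical
    let w : Node₁ n → Node₁ n → ℝ := fun p q =>
      if hpq : p ≠ q then 1 - x (arcOf p q hpq).1 - d (arcOf p q hpq) else 0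
    have hw : ∀ a : Arc₁ n, w a.src a.tgt = 1 - x a.1 - d a := by
      intro a
      have hne : a.src ≠ a.tgt := fun h' => a.1.2 (congrArg Subtype.val h')
      simp only [w, dif_pos hne]
      rfl
    obtain ⟨u, hu⟩ := exists_potential (w := w) <| closedWalk_nonneg (by simp [w]) <| by
      intro k v hv
      let e : Fin (k + 2) → Arc₁ n := fun i =>
        arcOf (v i) (v (i + 1)) (fun h => fin_ne_add_one i (hv h))
      have he : Function.Injective (fun i => (e i).src) := hv
      have h1 := h _ (isDirectedCycle_of_arcs e he (fun i => rfl))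
      rw [cycleSum_apply, Finset.card_image_of_injective _ (injective_of_src he),
        Finset.sum_image (injective_of_src he).injOn,
        Finset.sum_image (injective_of_src he).injOn] at h1
      have h2 : ∑ i, w (v i) (v (i + 1)) = ∑ i, (1 - x (e i).1 - d (e i)) :=
        Finset.sum_congr rfl fun i _ => hw (e i)
      rw [h2, Finset.sum_sub_distrib, Finset.sum_sub_distrib]
      simp only [Finset.card_univ, Finset.sum_const, nsmul_eq_mul, mul_one] at h1 ⊢
      linarith
    refine ⟨u, hx, fun a => ?_⟩
    have := hu a.src a.tgt
    rw [hw] at this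
    simp only
    linarith

end Cycles

/-! ### Linear spans and codimension -/

section Dimension

variable {E : Type*} [AddCommGroup E] [Module ℝ E]

theorem finrank_inf_ker_add_one [FiniteDimensional ℝ E] (U : Submodule ℝ E) (g : E →ₗ[ℝ] ℝ) {y : E} (hy : y ∈ U)
    (hgy : g y ≠ 0) : finrank ℝ ↥(U ⊓ LinearMap.ker g) + 1 = finrank ℝ U := by
  have h1 := LinearMap.finrank_range_add_finrank_ker (g.domRestrict U)
  have h2 : LinearMap.range (g.domRestrict U) = ⊤ :=
    LinearMap.range_eq_top.2 <| LinearMap.surjective fun h =>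
      hgy (by simpa using LinearMap.congr_fun h ⟨y, hy⟩)
  have h3 : LinearMap.ker (g.domRestrict U) = (LinearMap.ker g).comap U.subtype := rfl
  rw [h2, h3, finrank_top, finrank_self, ← Submodule.finrank_map_subtype_eq,
    Submodule.map_comap_subtype] at h1
  omega

theorem vectorSpan_le_ker {S : Set E} (g : E →ₗ[ℝ] ℝ) (c : ℝ) (h : ∀ x ∈ S, g x = c) :
    vectorSpan ℝ S ≤ LinearMap.ker g := by
  rw [vectorSpan_def, Submodule.span_le]
  rintro _ ⟨x, hx, y, hy, rfl⟩
  simp [h x hx, h y hy]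

theorem mem_vectorSpan_of_add_smul {S : Set E} {x y : E} (hx : x ∈ S) {t : ℝ} (ht : t ≠ 0)
    (h : x + t • y ∈ S) : y ∈ vectorSpan ℝ S := by
  have := vsub_mem_vectorSpan ℝ h hx
  rw [vsub_eq_sub, add_sub_cancel_left] at this
  exact (Submodule.smul_mem_iff _ ht).1 this

end Dimension

/-! ### Directions of the assignment polytope -/

section Flow

variable {n : ℕ}

/-- The vectors all of whose row and column sums vanish. -/
def flowSpace (n : ℕ) : Submodule ℝ (Arc n → ℝ) where
  carrier := {y | (∀ i : Fin n, ∑ a : Arc n with a.1.1 = i, y a = 0) ∧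
    ∀ i : Fin n, ∑ a : Arc n with a.1.2 = i, y a = 0}
  zero_mem' := by simp
  add_mem' := by
    rintro x y ⟨h1, h2⟩ ⟨h3, h4⟩
    simp [Finset.sum_add_distrib, h1, h2, h3, h4]
  smul_mem' := by
    rintro c x ⟨h1, h2⟩
    simp [← Finset.mul_sum, h1, h2]

theorem mem_PAP_of_nonneg {x : Arc n → ℝ} (h0 : ∀ a, 0 ≤ x a)
    (h1 : ∀ i : Fin n, ∑ a : Arc n with a.1.1 = i, x a = 1)
    (h2 : ∀ i : Fin n, ∑ a : Arc n with a.1.2 = i, x a = 1) : x ∈ PAP n := by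
  refine ⟨fun a => ⟨h0 a, ?_⟩, h1, h2⟩
  rw [← h1 a.1.1]
  exact Finset.single_le_sum (f := x) (fun b _ => h0 b) (by simp)

theorem sub_mem_flowSpace {x y : Arc n → ℝ} (hx : x ∈ PAP n) (hy : y ∈ PAP n) :
    x - y ∈ flowSpace n := by
  constructor
  · intro i
    simp [Finset.sum_sub_distrib, hx.2.1, hy.2.1]
  · intro i
    simp [Finset.sum_sub_distrib, hx.2.2, hy.2.2]

theorem vectorSpan_le_flowSpace {S : Set (Arc n → ℝ)} (hS : S ⊆ PAP n) :
    vectorSpan ℝ S ≤ flowSpace n := by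
  rw [vectorSpan_def, Submodule.span_le]
  rintro _ ⟨x, hx, y, hy, rfl⟩
  exact sub_mem_flowSpace (hS hx) (hS hy)

theorem sum_arc (g : Fin n × Fin n → ℝ) (h : ∀ i, g (i, i) = 0) :
    ∑ a : Arc n, g a.1 = ∑ i, ∑ j, g (i, j) := by
  rw [← Fintype.sum_prod_type, ← Finset.sum_subtype (univ.filter fun p : Fin n × Fin n => p.1 ≠ p.2)
    (by simp) g]
  refine Finset.sum_subset (Finset.filter_subset _ _) ?_
  rintro ⟨i, j⟩ _ hij
  obtain rfl : i = j := by simpa using hij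
  exact h i

theorem sum_arc_row (X : Fin n → Fin n → ℝ) (h : ∀ i, X i i = 0) (i : Fin n) :
    ∑ a : Arc n with a.1.1 = i, X a.1.1 a.1.2 = ∑ j, X i j := by
  rw [Finset.sum_filter, sum_arc (fun p => if p.1 = i then X p.1 p.2 else 0) (by simp [h])]
  rw [Finset.sum_eq_single i]
  · simp
  · intro b _ hb
    simp [hb]
  · simp

theorem sum_arc_col (X : Fin n → Fin n → ℝ) (h : ∀ i, X i i = 0) (i : Fin n) :
    ∑ a : Arc n with a.1.2 = i, X a.1.1 a.1.2 = ∑ j, X j i := by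
  rw [Finset.sum_filter, sum_arc (fun p => if p.2 = i then X p.1 p.2 else 0) (by simp [h])]
  simp

/-- A rectangle vector: it lies in the flow space, is nonzero at `a`, and is supported on arcs whose
head is different from the tail of `a`. -/
theorem exists_rectangle (hn : 4 ≤ n) (a : Arc n) :
    ∃ y ∈ flowSpace n, y a ≠ 0 ∧ ∀ b : Arc n, b.1.2 = a.1.1 → y b = 0 := by
  obtain ⟨⟨p, q⟩, hpq⟩ := a
  simp only at hpq
  obtain ⟨k, hk⟩ : ∃ k, k ∉ ({p, q} : Finset (Fin n)) := by
    by_contra! h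
    have h1 := Finset.card_le_card (fun x _ => h x : (univ : Finset (Fin n)) ⊆ _)
    have h2 := Finset.card_le_two (a := p) (b := q)
    simp at h1
    omega
  obtain ⟨l, hl⟩ : ∃ l, l ∉ ({p, q, k} : Finset (Fin n)) := by
    by_contra! h
    have h1 := Finset.card_le_card (fun x _ => h x : (univ : Finset (Fin n)) ⊆ _)
    have h2 := Finset.card_le_three (a := p) (b := q) (c := k)
    simp at h1
    omega
  simp only [Finset.mem_insert, Finset.mem_singleton, not_or] at hk hl
  -- The vector is the outer product of `r` and `c`, supported on `pq`, `pl`, `kq`, `kl`. The choice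
  -- of `k` and `l` keeps it off the diagonal and makes all heads differ from `p`.
  let r : Fin n → ℝ := fun i => (if i = p then 1 else 0) - (if i = k then 1 else 0)
  let c : Fin n → ℝ := fun i => (if i = q then 1 else 0) - (if i = l then 1 else 0)
  have hr : ∑ i, r i = 0 := by simp [r]
  have hc : ∑ i, c i = 0 := by simp [c]
  have hrc : ∀ i, r i * c i = 0 := by
    intro i
    simp only [r, c]
    rcases eq_or_ne i p with rfl | h1
    · simp [hpq, Ne.symm hl.1]
    · rcases eq_or_ne i k with rfl | h2
      · simp [hk.2, Ne.symm hl.2.2]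
      · simp [h1, h2]
  refine ⟨fun b => r b.1.1 * c b.1.2, ⟨fun i => ?_, fun i => ?_⟩, ?_, ?_⟩
  · rw [sum_arc_row (fun i j => r i * c j) hrc, ← Finset.mul_sum, hc, mul_zero]
  · rw [sum_arc_col (fun i j => r i * c j) hrc, ← Finset.sum_mul, hr, zero_mul]
  · simp [r, c, Ne.symm hk.1, Ne.symm hl.2.1]
  · rintro ⟨⟨i, j⟩, hij⟩ h
    simp only at h
    subst h
    simp [c, hpq, Ne.symm hl.1]

/-- A set on which the coordinates of two consecutive arcs are constant has codimension at least
two. -/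
theorem dimension_add_two_le (hn : 4 ≤ n) {S : Set (Arc n → ℝ)} (hS : S ⊆ PAP n) (a b : Arc n)
    (hab : a.1.2 = b.1.1) {s t : ℝ} (ha : ∀ x ∈ S, x a = s) (hb : ∀ x ∈ S, x b = t) :
    dimension S + 2 ≤ finrank ℝ (flowSpace n) := by
  obtain ⟨y, hy, hya, -⟩ := exists_rectangle hn a
  obtain ⟨z, hz, hzb, hz0⟩ := exists_rectangle hn b
  have h1 := finrank_inf_ker_add_one (flowSpace n) (LinearMap.proj a) hy hya
  -- As the head of `a` is the tail of `b`, the rectangle at `b` vanishes at `a`, so the second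
  -- equation cuts the first kernel properly.
  have h2 := finrank_inf_ker_add_one (flowSpace n ⊓ LinearMap.ker (LinearMap.proj a))
    (LinearMap.proj b) (y := z) ⟨hz, hz0 a hab⟩ hzb
  have h3 : vectorSpan ℝ S ≤ (flowSpace n ⊓ LinearMap.ker (LinearMap.proj a)) ⊓
      LinearMap.ker (LinearMap.proj b) :=
    le_inf (le_inf (vectorSpan_le_flowSpace hS) (vectorSpan_le_ker _ s ha))
      (vectorSpan_le_ker _ t hb)
  have h4 := Submodule.finrank_mono h3
  unfold dimension
  omega

/-- From a point satisfying strictly all constraints except those that are constant along `y`, one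
can move a little in the direction `y`. -/
theorem exists_add_smul_mem_PMTZ {d : Arc₁ n → ℝ} {x y : Arc n → ℝ} (hx : x ∈ PAP n)
    (hpos : ∀ a, 0 < x a) (hy : y ∈ flowSpace n)
    (h : ∀ C, IsDirectedCycle C → cycleSum C x < (C.card : ℝ) - ∑ a ∈ C, d a ∨
      (cycleSum C x = (C.card : ℝ) - ∑ a ∈ C, d a ∧ cycleSum C y = 0)) :
    ∃ t : ℝ, t ≠ 0 ∧ x + t • y ∈ PMTZ d := by
  have h1 : ∀ᶠ t : ℝ in nhdsWithin 0 (Set.Ioi 0), ∀ a, 0 < x a + t * y a := by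
    refine Filter.eventually_all.2 fun a => nhdsWithin_le_nhds ?_
    have hc : Continuous fun t : ℝ => x a + t * y a := by fun_prop
    exact hc.continuousAt.eventually_const_lt (by simpa using hpos a)
  have h2 : ∀ᶠ t : ℝ in nhdsWithin 0 (Set.Ioi 0), ∀ C, IsDirectedCycle C →
      cycleSum C x + t * cycleSum C y ≤ (C.card : ℝ) - ∑ a ∈ C, d a := by
    refine Filter.eventually_all.2 fun C => nhdsWithin_le_nhds ?_
    by_cases hC : IsDirectedCycle C
    · rcases h C hC with h | ⟨h, h'⟩
      · have hc : Continuous fun t : ℝ => cycleSum C x + t * cycleSum C y := by fun_prop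
        have hlt := (hc.tendsto 0).eventually_lt_const (u := (C.card : ℝ) - ∑ a ∈ C, d a)
          (by simpa using h)
        exact hlt.mono fun t ht _ => ht.le
      · simp [h, h']
    · simp [hC]
  obtain ⟨t, ⟨ht1, ht2⟩, ht0⟩ := ((h1.and h2).and self_mem_nhdsWithin).exists
  refine ⟨t, ne_of_gt ht0, mem_PMTZ_iff.2 ⟨mem_PAP_of_nonneg (fun a => (ht1 a).le) ?_ ?_, ?_⟩⟩
  · intro i
    simp [Finset.sum_add_distrib, ← Finset.mul_sum, hx.2.1, hy.1]
  · intro i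
    simp [Finset.sum_add_distrib, ← Finset.mul_sum, hx.2.2, hy.2]
  · intro C hC
    simpa using ht2 C hC

/-! ### Positive points of the assignment polytope -/

/-- Arcs touching `S` get `e`, the others `g`, and arcs marked by `c` get an extra `κ`. `h1` is the
row sum at a node of `S`, `h2` the row sum at a node outside. -/
theorem sum_row_aux (S : Finset (Fin n)) (i : Fin n) (c : Fin n → ℝ) {e g κ : ℝ}
    (hc : ∑ j, c j = if i ∈ S then 1 else 0) (hci : c i = 0)
    (h1 : ((n : ℝ) - 1) * e + κ = 1) (h2 : (S.card : ℝ) * e + ((n : ℝ) - S.card - 1) * g = 1) :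
    ∑ j, (if i = j then 0 else (if i ∈ S ∨ j ∈ S then e else g) + κ * c j) = 1 := by
  have hs : ∀ j, (if i = j then 0 else (if i ∈ S ∨ j ∈ S then e else g) + κ * c j) =
      (if i ∈ S ∨ j ∈ S then e else g) + κ * c j - if i = j then (if i ∈ S then e else g) else 0 := by
    intro j
    split_ifs <;> simp_all
  simp only [hs, Finset.sum_sub_distrib, Finset.sum_add_distrib, ← Finset.mul_sum, hc]
  by_cases hi : i ∈ S
  · simp [hi]
    linarith
  · have : ∀ j, (if j ∈ S then e else g) = g + if j ∈ S then e - g else 0 := by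
      intro j; split_ifs <;> ring
    simp [hi, this, Finset.sum_add_distrib]
    linarith

theorem sums_eq_one (S : Finset (Fin n)) (c : Fin n → Fin n → ℝ) {e g κ : ℝ}
    (hrow : ∀ i, ∑ j, c i j = if i ∈ S then 1 else 0)
    (hcol : ∀ j, ∑ i, c i j = if j ∈ S then 1 else 0) (hdiag : ∀ i, c i i = 0)
    (h1 : ((n : ℝ) - 1) * e + κ = 1) (h2 : (S.card : ℝ) * e + ((n : ℝ) - S.card - 1) * g = 1)
    {x : Arc n → ℝ}
    (hx : ∀ a, x a = (if a.1.1 ∈ S ∨ a.1.2 ∈ S then e else g) + κ * c a.1.1 a.1.2) :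
    (∀ i : Fin n, ∑ a : Arc n with a.1.1 = i, x a = 1) ∧
      ∀ i : Fin n, ∑ a : Arc n with a.1.2 = i, x a = 1 := by
  let X : Fin n → Fin n → ℝ := fun i j =>
    if i = j then 0 else (if i ∈ S ∨ j ∈ S then e else g) + κ * c i j
  have hX : ∀ a : Arc n, x a = X a.1.1 a.1.2 := fun a => by
    simp only [X, if_neg a.2, hx a]
  simp only [hX]
  constructor
  · intro i
    rw [sum_arc_row X (by simp [X]) i]
    exact sum_row_aux S i (c i) (hrow i) (hdiag i) h1 h2
  · intro i
    rw [sum_arc_col X (by simp [X]) i, ← sum_row_aux S i (fun j => c j i) (hcol i) (hdiag i) h1 h2]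
    refine Finset.sum_congr rfl fun j _ => ?_
    simp only [X, eq_comm (a := i), or_comm (a := i ∈ S)]

/-- The uniform point satisfies all cycle inequalities strictly. -/
theorem exists_uniform (hn : 4 ≤ n) : ∃ x ∈ PAP n, (∀ a, 0 < x a) ∧
    ∀ C, IsDirectedCycle C → cycleSum C x < (C.card : ℝ) - 1 := by
  have hn' : (4 : ℝ) ≤ n := by exact_mod_cast hn
  have hpos : (0 : ℝ) < n - 1 := by linarith
  obtain ⟨h1, h2⟩ := sums_eq_one (n := n) ∅ (fun _ _ => 0) (e := 1 / ((n : ℝ) - 1))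
    (g := 1 / ((n : ℝ) - 1)) (κ := 0) (x := fun _ => 1 / ((n : ℝ) - 1)) (by simp) (by simp)
    (by simp) (by field_simp; simp) (by simp; field_simp) (by simp)
  refine ⟨fun _ => 1 / ((n : ℝ) - 1), mem_PAP_of_nonneg (fun _ => by positivity) h1 h2,
    fun _ => by positivity, fun C hC => ?_⟩
  have hc : (2 : ℝ) ≤ C.card := by exact_mod_cast hC.two_le_card
  rw [cycleSum_apply]
  simp only [Finset.sum_const, nsmul_eq_mul]
  rw [mul_one_div, div_lt_iff₀ hpos]
  nlinarith

/-- A positive point of the assignment polytope on the hyperplane of a given cycle which satisfies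
all other cycle inequalities strictly. -/
theorem IsDirectedCycle.exists_point {C : Finset (Arc₁ n)} (hC : IsDirectedCycle C)
    (hcard : C.card ≤ n - 2) {δ : ℝ} (hδ : 0 < δ) (hδ1 : δ ≤ 1) :
    ∃ x ∈ PAP n, (∀ a, 0 < x a) ∧ cycleSum C x = (C.card : ℝ) - δ ∧
      ∀ C', IsDirectedCycle C' → C' ≠ C → cycleSum C' x < (C'.card : ℝ) - 1 := by
  have hk2 := hC.two_le_card
  have hk : (2 : ℝ) ≤ C.card := by exact_mod_cast hk2
  have hkn : (C.card : ℝ) + 2 ≤ n := by exact_mod_cast (by omega : C.card + 2 ≤ n)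
  let S : Finset (Fin n) := C.image fun a => a.1.1.1
  have hSrc : ∀ a ∈ C, a.1.1.1 ∈ S := fun a ha => Finset.mem_image_of_mem _ ha
  have hS : ∀ i, i ∈ S → ∃ a ∈ C, a.1.1.1 = i := fun i hi => by simpa [S] using hi
  have hTgt : ∀ a ∈ C, a.1.1.2 ∈ S := fun a ha => by
    obtain ⟨b, hb, hba⟩ := hC.exists_succ ha
    rw [← show b.1.1.1 = a.1.1.2 from congrArg Subtype.val hba]
    exact hSrc b hb
  have hS' : ∀ i, i ∈ S → ∃ a ∈ C, a.1.1.2 = i := fun i hi => by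
    obtain ⟨b, hb, rfl⟩ := hS i hi
    obtain ⟨a, ha, -, hab⟩ := hC.exists_pred hb
    exact ⟨a, ha, congrArg Subtype.val hab⟩
  have hScard : S.card = C.card := Finset.card_image_of_injOn fun a ha b hb hab =>
    hC.eq_of_src_eq ha hb (Subtype.ext hab)
  let I : Finset (Fin n × Fin n) := C.image fun a => a.1.1
  have hI : ∀ p, p ∈ I → ∃ a ∈ C, a.1.1 = p := fun p hp => by simpa [I] using hp
  have hmemI : ∀ a : Arc₁ n, a.1.1 ∈ I ↔ a ∈ C := fun a => by
    refine ⟨fun h => ?_, fun h => Finset.mem_image_of_mem _ h⟩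
    obtain ⟨b, hb, hba⟩ := hI _ h
    rwa [← show b = a from Subtype.ext (Subtype.ext hba)]
  let c : Fin n → Fin n → ℝ := fun i j => if (i, j) ∈ I then 1 else 0
  have hrow : ∀ i, ∑ j, c i j = if i ∈ S then 1 else 0 := by
    intro i
    split_ifs with hi
    · obtain ⟨a, ha, rfl⟩ := hS i hi
      rw [Finset.sum_eq_single a.1.1.2]
      · exact if_pos ((hmemI a).2 ha)
      · intro j _ hj
        refine if_neg fun h => hj ?_
        obtain ⟨b, hb, hba⟩ := hI _ h
        have h1 : b.1.1.1 = a.1.1.1 := by rw [hba]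
        rw [← hC.eq_of_src_eq hb ha (Subtype.ext h1), hba]
      · simp
    · refine Finset.sum_eq_zero fun j _ => if_neg fun h => hi ?_
      obtain ⟨b, hb, hba⟩ := hI _ h
      rw [← show b.1.1.1 = i from congrArg Prod.fst hba]
      exact hSrc b hb
  have hcol : ∀ j, ∑ i, c i j = if j ∈ S then 1 else 0 := by
    intro i
    split_ifs with hi
    · obtain ⟨a, ha, rfl⟩ := hS' i hi
      rw [Finset.sum_eq_single a.1.1.1]
      · exact if_pos ((hmemI a).2 ha)
      · intro j _ hj
        refine if_neg fun h => hj ?_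
        obtain ⟨b, hb, hba⟩ := hI _ h
        have h1 : b.1.1.2 = a.1.1.2 := by rw [hba]
        rw [← hC.eq_of_tgt_eq hb ha (Subtype.ext h1), hba]
      · simp
    · refine Finset.sum_eq_zero fun j _ => if_neg fun h => hi ?_
      obtain ⟨b, hb, hba⟩ := hI _ h
      rw [← show b.1.1.2 = i from congrArg Prod.snd hba]
      exact hTgt b hb
  have hdiag : ∀ i, c i i = 0 := fun i => if_neg fun h => by
    obtain ⟨b, -, hba⟩ := hI _ h
    exact b.1.2 (by rw [hba])
  -- Cycle arcs will have value `1 - ε`, giving total `|C| - δ`. The row sums then force `e = ε / (n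
  -- - 2)` on other arcs touching the cycle, and the value `g` away from it.
  obtain ⟨ε, hε⟩ : ∃ ε, ε = δ / C.card := ⟨_, rfl⟩
  have hkε : (C.card : ℝ) * ε = δ := by rw [hε]; field_simp
  have hε0 : 0 < ε := by rw [hε]; positivity
  have hε2 : ε ≤ 1 / 2 := by nlinarith
  obtain ⟨e, he⟩ : ∃ e, e = ε / ((n : ℝ) - 2) := ⟨_, rfl⟩
  have hn2 : (0 : ℝ) < n - 2 := by linarith
  have hne : ((n : ℝ) - 2) * e = ε := by rw [he]; field_simp
  have he0 : 0 < e := by rw [he]; positivity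
  have heε : 2 * e ≤ ε := by nlinarith
  have hm : (0 : ℝ) < n - C.card - 1 := by linarith
  obtain ⟨g, hg⟩ : ∃ g, g = (1 - C.card * e) / ((n : ℝ) - C.card - 1) := ⟨_, rfl⟩
  have hmg : (C.card : ℝ) * e + ((n : ℝ) - C.card - 1) * g = 1 := by rw [hg]; field_simp; ring
  have hke : (C.card : ℝ) * e < 1 := by nlinarith
  have hg0 : 0 < g := by rw [hg]; exact div_pos (by linarith) hm
  obtain ⟨x, hx⟩ : ∃ x : Arc n → ℝ, ∀ a, x a =
    (if a.1.1 ∈ S ∨ a.1.2 ∈ S then e else g) + (1 - ε - e) * c a.1.1 a.1.2 := ⟨_, fun _ => rfl⟩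
  obtain ⟨hr, hc⟩ := sums_eq_one S c hrow hcol hdiag (by linarith) (by rwa [hScard]) hx
  have hpos : ∀ a, 0 < x a := fun a => by
    rw [hx]
    have h1 : 0 < if a.1.1 ∈ S ∨ a.1.2 ∈ S then e else g := by split_ifs <;> assumption
    have h2 : 0 ≤ (1 - ε - e) * c a.1.1 a.1.2 :=
      mul_nonneg (by linarith) (by simp only [c]; split_ifs <;> norm_num)
    linarith
  have hxP : x ∈ PAP n := mem_PAP_of_nonneg (fun a => (hpos a).le) hr hc
  have hxC : ∀ a ∈ C, x a.1 = 1 - ε := fun a ha => by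
    rw [hx, if_pos (Or.inl (hSrc a ha)), show c a.1.1.1 a.1.1.2 = 1 from if_pos ((hmemI a).2 ha)]
    ring
  have hxe : ∀ a : Arc₁ n, a ∉ C → a.1.1.1 ∈ S ∨ a.1.1.2 ∈ S → x a.1 = e := fun a ha hS => by
    rw [hx, if_pos hS, show c a.1.1.1 a.1.1.2 = 0 from if_neg (mt (hmemI a).1 ha)]
    ring
  have hxhalf : ∀ a : Arc₁ n, a ∉ C → x a.1 < 1 / 2 := fun a ha => by
    by_cases haS : a.1.1.1 ∈ S ∨ a.1.1.2 ∈ S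
    · rw [hxe a ha haS]
      linarith
    · rw [hx, if_neg haS, show c a.1.1.1 a.1.1.2 = 0 from if_neg (mt (hmemI a).1 ha)]
      -- The special node and both ends of `a` lie outside `S`, so the denominator of `g` is at
      -- least 2.
      have h3 : C.card + 3 ≤ n := by
        let z : Fin n := ⟨0, by omega⟩
        have hz : ∀ b : Arc₁ n, z ≠ b.1.1.1 ∧ z ≠ b.1.1.2 := fun b =>
          ⟨fun h => b.2.1 (congrArg Fin.val h).symm, fun h => b.2.2 (congrArg Fin.val h).symm⟩
        have hzS : z ∉ S := fun h => by
          obtain ⟨b, -, hb⟩ := hS z h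
          exact (hz b).1 hb.symm
        push Not at haS
        have h1 := (insert z (insert a.1.1.1 (insert a.1.1.2 S))).card_le_univ
        rw [Finset.card_insert_of_notMem, Finset.card_insert_of_notMem,
          Finset.card_insert_of_notMem haS.2, hScard, Fintype.card_fin] at h1
        · exact h1
        · simp [a.1.2, haS.1]
        · simp [(hz a).1, (hz a).2, hzS]
      have h3' : (C.card : ℝ) + 3 ≤ n := by exact_mod_cast h3
      have : 0 < (C.card : ℝ) * e := by positivity
      nlinarith
  refine ⟨x, hxP, hpos, ?_, fun C' hC' hne' => ?_⟩
  · rw [cycleSum_apply, Finset.sum_congr rfl hxC]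
    simp only [Finset.sum_const, nsmul_eq_mul]
    linarith
  · obtain ⟨b, hb, hbC⟩ : ∃ b ∈ C', b ∉ C := by
      by_contra! h
      exact hne' (hC.eq_of_subset hC' h)
    obtain ⟨a, ha, hab, hat⟩ := hC'.exists_pred hb
    have h1 : (1 - x a.1) + (1 - x b.1) ≤ ∑ a ∈ C', (1 - x a.1) := by
      rw [← Finset.sum_pair hab (f := fun a : Arc₁ n => 1 - x a.1)]
      refine Finset.sum_le_sum_of_subset_of_nonneg ?_ fun a _ _ => sub_nonneg.2 (hxP.1 a.1).2
      simp [Finset.insert_subset_iff, ha, hb]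
    -- If `a` lies in `C`, then `b` leaves a node of `C`, and the slack is `ε + 1 - e` with `e < ε`.
    -- Otherwise both values are below one half.
    have h2 : 1 < (1 - x a.1) + (1 - x b.1) := by
      by_cases haC : a ∈ C
      · have : b.1.1.1 ∈ S := by
          rw [← show a.1.1.2 = b.1.1.1 from congrArg Subtype.val hat]
          exact hTgt a haC
        rw [hxC a haC, hxe b hbC (Or.inl this)]
        linarith
      · have := hxhalf a haC
        have := hxhalf b hbC
        linarith
    rw [Finset.sum_sub_distrib] at h1
    simp only [Finset.sum_const, nsmul_eq_mul, mul_one] at h1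
    rw [cycleSum_apply]
    linarith

/-! ### Dimension of the polytope and the facet criterion -/

/-- The total weight of the arcs avoiding the special node. -/
theorem sum_arc₁ (hn : 1 ≤ n) {x : Arc n → ℝ} (hx : x ∈ PAP n) :
    ∑ a : Arc₁ n, x a.1 = (n : ℝ) - 2 := by
  let z : Fin n := ⟨0, hn⟩
  have hz : ∀ i : Fin n, i.val ≠ 0 ↔ i ≠ z := fun i => by simp [z, Fin.ext_iff]
  have h0 : ∑ a : Arc n, x a = n := by
    rw [← Finset.sum_fiberwise univ (fun a : Arc n => a.1.1) x]
    simp [hx.2.1]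
  have h1 : ∑ a : Arc₁ n, x a.1 =
      ∑ a : Arc n with a.1.1.val ≠ 0 ∧ a.1.2.val ≠ 0, x a :=
    (Finset.sum_subtype _ (by simp) x).symm
  have h2 : ∑ a : Arc n with a.1.1.val ≠ 0 ∧ a.1.2.val ≠ 0, x a = ∑ a : Arc n, x a
      - ∑ a : Arc n with a.1.1 = z, x a - ∑ a : Arc n with a.1.2 = z, x a := by
    simp only [Finset.sum_filter, ← Finset.sum_sub_distrib]
    refine Finset.sum_congr rfl fun a _ => ?_
    simp only [hz]
    have := a.2
    by_cases h : a.1.1 = z <;> by_cases h' : a.1.2 = z <;> simp_all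
  rw [h1, h2, h0, hx.2.1, hx.2.2]
  ring

theorem closure_paramD {d : Arc₁ n → ℝ} (hd : d ∈ closure (paramD n)) :
    (∀ a, 0 ≤ d a) ∧ ∀ C : Finset (Arc₁ n), IsDirectedCycle C → ∑ a ∈ C, d a ≤ 1 :=
  ⟨fun a => closure_minimal (t := {d : Arc₁ n → ℝ | 0 ≤ d a}) (fun _ h => (h.1 a).le)
    (isClosed_le continuous_const (continuous_apply a)) hd,
  fun C hC => closure_minimal (t := {d : Arc₁ n → ℝ | ∑ a ∈ C, d a ≤ 1})
    (fun _ h => h.2 C hC)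
    (isClosed_le (by fun_prop) continuous_const) hd⟩

theorem dimension_PMTZ (hn : 4 ≤ n) {d : Arc₁ n → ℝ} (hd : d ∈ closure (paramD n)) :
    dimension (PMTZ d) = finrank ℝ (flowSpace n) := by
  obtain ⟨x, hx, hpos, hlt⟩ := exists_uniform hn
  have hlt' : ∀ C, IsDirectedCycle C → cycleSum C x < (C.card : ℝ) - ∑ a ∈ C, d a :=
    fun C hC => by
      have := hlt C hC
      have := (closure_paramD hd).2 C hC
      linarith
  have hxP : x ∈ PMTZ d := mem_PMTZ_iff.2 ⟨hx, fun C hC => (hlt' C hC).le⟩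
  have : vectorSpan ℝ (PMTZ d) = flowSpace n := by
    refine le_antisymm (vectorSpan_le_flowSpace fun x hx => (mem_PMTZ_iff.1 hx).1) fun y hy => ?_
    obtain ⟨t, ht, h⟩ := exists_add_smul_mem_PMTZ hx hpos hy fun C hC => Or.inl (hlt' C hC)
    exact mem_vectorSpan_of_add_smul hxP ht h
  rw [dimension, this]

theorem definesFacet_of_pos (hn : 4 ≤ n) {d : Arc₁ n → ℝ} (hd : d ∈ closure (paramD n))
    {C : Finset (Arc₁ n)} (hC : IsDirectedCycle C) (hpos : 0 < ∑ a ∈ C, d a)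
    (hcard : C.card ≤ n - 2) :
    DefinesFacet (PMTZ d) (cycleSum C) ((C.card : ℝ) - ∑ a ∈ C, d a) := by
  have hd1 := (closure_paramD hd).2
  obtain ⟨x, hx, hx0, hxC, hxlt⟩ := hC.exists_point hcard hpos (hd1 C hC)
  obtain ⟨x', hx', -, hx'lt⟩ := exists_uniform hn
  have hxlt' : ∀ C', IsDirectedCycle C' → C' ≠ C →
      cycleSum C' x < (C'.card : ℝ) - ∑ a ∈ C', d a := fun C' hC' hne => by
    have := hxlt C' hC' hne
    have := hd1 C' hC'
    linarith
  have hxP : x ∈ PMTZ d := mem_PMTZ_iff.2 ⟨hx, fun C' hC' => by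
    rcases eq_or_ne C' C with rfl | hne
    · exact hxC.le
    · exact (hxlt' C' hC' hne).le⟩
  refine ⟨fun y hy => (mem_PMTZ_iff.1 hy).2 C hC, ⟨x, hxP, hxC⟩, ?_⟩
  have hspan : vectorSpan ℝ {y ∈ PMTZ d | cycleSum C y = (C.card : ℝ) - ∑ a ∈ C, d a} =
      flowSpace n ⊓ LinearMap.ker (cycleSum C) := by
    refine le_antisymm (le_inf (vectorSpan_le_flowSpace fun y hy => (mem_PMTZ_iff.1 hy.1).1)
      (vectorSpan_le_ker _ _ fun y hy => hy.2)) ?_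
    rintro y ⟨hy, hyC⟩
    have hyC : cycleSum C y = 0 := hyC
    obtain ⟨t, ht, h⟩ := exists_add_smul_mem_PMTZ (d := d) hx hx0 hy fun C' hC' => by
      rcases eq_or_ne C' C with rfl | hne
      · exact Or.inr ⟨hxC, hyC⟩
      · exact Or.inl (hxlt' C' hC' hne)
    exact mem_vectorSpan_of_add_smul ⟨hxP, hxC⟩ ht ⟨h, by simp [hxC, hyC]⟩
  rw [dimension_PMTZ hn hd, dimension, hspan]
  -- The cycle sum is nonzero on `flowSpace`: it separates the tight point from the uniform one.
  refine finrank_inf_ker_add_one _ _ (sub_mem_flowSpace hx hx') ?_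
  have := hx'lt C hC
  have := hd1 C hC
  rw [map_sub, hxC]
  exact (by linarith : (0 : ℝ) < _).ne'

theorem pos_of_definesFacet (hn : 4 ≤ n) {d : Arc₁ n → ℝ} (hd : d ∈ closure (paramD n))
    {C : Finset (Arc₁ n)} (hC : IsDirectedCycle C)
    (h : DefinesFacet (PMTZ d) (cycleSum C) ((C.card : ℝ) - ∑ a ∈ C, d a)) :
    0 < ∑ a ∈ C, d a := by
  refine (Finset.sum_nonneg fun a _ => (closure_paramD hd).1 a).lt_of_ne' fun h0 => ?_
  obtain ⟨-, -, hdim⟩ := h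
  rw [dimension_PMTZ hn hd, h0, sub_zero] at hdim
  obtain ⟨b, hb⟩ : C.Nonempty := Finset.card_pos.1 (by have := hC.two_le_card; omega)
  obtain ⟨a, ha, -, hab⟩ := hC.exists_pred hb
  -- Coordinates are at most one, so a cycle sum equal to `|C|` forces each of them to be one.
  have key : ∀ x ∈ {x ∈ PMTZ d | cycleSum C x = C.card}, ∀ a ∈ C, x a.1 = 1 := by
    rintro x ⟨hx, hxC⟩ a ha
    rw [cycleSum_apply] at hxC
    refine (Finset.sum_eq_sum_iff_of_le (g := fun _ => (1 : ℝ))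
      fun a _ => ((mem_PMTZ_iff.1 hx).1.1 a.1).2).1 (by simpa using hxC) a ha
  have := dimension_add_two_le hn (fun x hx => (mem_PMTZ_iff.1 hx.1).1) a.1 b.1
    (congrArg Subtype.val hab) (fun x hx => key x hx a ha) (fun x hx => key x hx b hb)
  omega

theorem card_le_of_definesFacet (hn : 4 ≤ n) {d : Arc₁ n → ℝ} (hd : d ∈ closure (paramD n))
    {C : Finset (Arc₁ n)} (hC : IsDirectedCycle C)
    (h : DefinesFacet (PMTZ d) (cycleSum C) ((C.card : ℝ) - ∑ a ∈ C, d a)) :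
    C.card ≤ n - 2 := by
  by_contra! hlt
  obtain ⟨-, -, hdim⟩ := h
  rw [dimension_PMTZ hn hd] at hdim
  have hd1 := (closure_paramD hd).2 C hC
  have hcard : (n : ℝ) - 1 ≤ C.card := by
    have : (n : ℝ) ≤ C.card + 1 := by exact_mod_cast (by omega : n ≤ C.card + 1)
    linarith
  -- The arcs avoiding the special node have total weight `n - 2`, and `C` alone already carries at
  -- least that much.
  have key : ∀ x ∈ {x ∈ PMTZ d | cycleSum C x = (C.card : ℝ) - ∑ a ∈ C, d a},
      ∀ a ∉ C, x a.1 = 0 := by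
    rintro x ⟨hx, hxC⟩ a ha
    have hxP := (mem_PMTZ_iff.1 hx).1
    have h1 := sum_arc₁ (by omega) hxP
    have h2 : ∑ b ∈ insert a C, x b.1 ≤ ∑ b : Arc₁ n, x b.1 :=
      Finset.sum_le_univ_sum_of_nonneg fun b : Arc₁ n => (hxP.1 b.1).1
    rw [Finset.sum_insert ha] at h2
    rw [cycleSum_apply] at hxC
    have := (hxP.1 a.1).1
    linarith
  obtain ⟨k, e, he, hs, hmem⟩ := hC.exists_arcs
  have hk : C.card = k + 2 := by
    rw [eq_image_of_mem_iff hmem, Finset.card_image_of_injective _ (injective_of_src he)]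
    simp
  have hne : ∀ i, (e (i + 1)).src ≠ (e i).src := fun i h => fin_ne_add_one i (he h).symm
  -- A reversed arc lies in `C` only if `C` has length two, but here `|C| ≥ n - 1 ≥ 3`.
  have hrev : ∀ i, arcOf _ _ (hne i) ∉ C := by
    intro i hi
    obtain ⟨j, hj⟩ := (hmem _).1 hi
    have h1 : (e j).src = (e (i + 1)).src := by rw [hj]; rfl
    have h2 : (e (j + 1)).src = (e i).src := by rw [← hs, hj]; rfl
    have h3 := he h1
    have h4 := he h2
    rw [h3, add_assoc] at h4
    have h5 : (1 + 1 : Fin (k + 2)) = 0 := by simpa using h4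
    have h6 := congrArg Fin.val h5
    obtain ⟨k, rfl⟩ : ∃ k', k = k' + 1 := ⟨k - 1, by omega⟩
    simp [Fin.val_add, Nat.mod_eq_of_lt (show 2 < k + 1 + 2 by omega)] at h6
  have := dimension_add_two_le hn (fun x hx => (mem_PMTZ_iff.1 hx.1).1)
    (arcOf _ _ (hne (0 + 1))).1 (arcOf _ _ (hne 0)).1 rfl
    (fun x hx => key x hx _ (hrev _)) (fun x hx => key x hx _ (hrev _))
  omega

end Flow

end ATSP

theorem mainTheorem8 (n : ℕ) (hn : 4 ≤ n) (d : ATSP.Arc₁ n → ℝ) (hd : d ∈ closure (ATSP.paramD n))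
    (C : Finset (ATSP.Arc₁ n)) (hC : ATSP.IsDirectedCycle C) :
    ATSP.DefinesFacet (ATSP.PMTZ d) (ATSP.cycleSum C) ((C.card : ℝ) - ∑ a ∈ C, d a) ↔
      0 < ∑ a ∈ C, d a ∧ C.card ≤ n - 2 :=
  ⟨fun h => ⟨ATSP.pos_of_definesFacet hn hd hC h, ATSP.card_le_of_definesFacet hn hd hC h⟩,
    fun h => ATSP.definesFacet_of_pos hn hd hC h.1 h.2⟩
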